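/- A single-sorted equational theory $\mathbb{T}$ is a set of equations between terms over a signature $\Sigma$ of finitary operation symbols; $\mathbb{T}\mathsf{mod}$ is the category of its set-based models and homomorphisms. A function symbol $f\in\Sigma$ of arity $n\ge 1$ is a projection in $\mathbb{T}$ if $\mathbb{T}\vdash f(y_1,\dots,y_n)=y_i$ for some $1\le i\le n$, and constant in $\mathbb{T}$ if $\mathbb{T}\vdash f(y_1,\dots,y_n)=s$ for some term $s$ in which none of the variables $y_1,\dots,y_n$ occurs (here $y_1,\dots,y_n$ are pairwise distinct variables). For a model $M$, let $\mathcal{Z}_{\mathbb{T}}(M)$ be the group of natural automorphisms of the forgetful functor $M/\mathbb{T}\mathsf{mod}\to\mathbb{T}\mathsf{mod}$ from the category of homomorphisms out of $M$. Let $\mathbb{T}_1,\mathbb{T}_2$ be equational theories over disjoint signatures $\Sigma_1,\Sigma_2$, and suppose that for each $i\in\{1,2\}$ the signature $\Sigma_i$ contains a function symbol of arity at least $1$ that is neither constant nor a projection in $\mathbb{T}_i$. Let $\mathbb{T}_1+\mathbb{T}_2$ be the equational theory over $\Sigma_1\cup\Sigma_2$ whose axioms are those of $\mathbb{T}_1$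 together with those of $\mathbb{T}_2$, and let $M_0$ be its free model on $0$ generators (closed terms modulo provable equality). Then $M_0$ is an initial object of $(\mathbb{T}_1+\mathbb{T}_2)\mathsf{mod}$; the canonical homomorphism $$\mathsf{Aut}\left(\mathsf{Id}_{(\mathbb{T}_1+\mathbb{T}_2)\mathsf{mod}}\right)\to\mathcal{Z}_{\mathbb{T}_1+\mathbb{T}_2}(M_0),\qquad \alpha\mapsto(\alpha_{N})_{h:M_0\to N},$$ is an isomorphism; and both groups are trivial. Thus the only natural automorphism of the identity functor of $(\mathbb{T}_1+\mathbb{T}_2)\mathsf{mod}$ is the identity, and the only invertible element of the centre of this category (the monoid of natural endomorphisms of its identity functor) is the identity. -/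

import Mathlib

open CategoryTheory
open scoped FirstOrder

universe u₁ v₁ u₂ v₂ w

/-- A single-sorted equational theory over a signature (a first-order language whose relation
symbols play no role): a set of equations between terms in countably many variables. -/
abbrev EqTheory (L : FirstOrder.Language) := Set (L.Term ℕ × L.Term ℕ)

namespace EqTheory

universe u u' v v'

/-- `T.Provable s t`: the equation `s = t` is derivable from `T` in equational logic, for terms
with variables (or adjoined constants) in `α`. -/
inductive Provable {L : FirstOrder.Language.{u, v}} (T : EqTheory L) {α : Type w} :
    L.Term α → L.Term α → Prop
  | ax {s t : L.Term ℕ} (h : (s, t) ∈ T) (σ : ℕ → L.Term α) :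
      Provable T (s.subst σ) (t.subst σ)
  | refl (t : L.Term α) : Provable T t t
  | symm {s t : L.Term α} : Provable T s t → Provable T t s
  | trans {r s t : L.Term α} : Provable T r s → Provable T s t → Provable T r t
  | congr {n : ℕ} (f : L.Functions n) {s t : Fin n → L.Term α} :
      (∀ i, Provable T (s i) (t i)) → Provable T (.func f s) (.func f t)

/-- The term `f(y_0, …, y_{n-1})` in pairwise distinct variables. -/
def generic {L : FirstOrder.Language.{u, v}} {n : ℕ} (f : L.Functions n) : L.Term ℕ :=
  .func f fun i => .var (i : ℕ)

/-- `f` is a projection in `T`. -/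
def IsProjection {L : FirstOrder.Language.{u, v}} (T : EqTheory L) {n : ℕ} (f : L.Functions n) : Prop :=
  ∃ i : Fin n, T.Provable (generic f) (.var (i : ℕ))

/-- `f` is constant in `T`: it is provably equal to a term `s` in which none of the variables
`y_0, …, y_{n-1}` occurs. -/
def IsConstant {L : FirstOrder.Language.{u, v}} (T : EqTheory L) {n : ℕ} (f : L.Functions n) : Prop :=
  ∃ s : L.Term ℕ, (∀ i : Fin n, (i : ℕ) ∉ s.varFinset) ∧ T.Provable (generic f) s

/-- The union `T₁ + T₂`, over the disjoint union of the signatures. -/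
def sum {L₁ : FirstOrder.Language.{u, v}} {L₂ : FirstOrder.Language.{u', v'}} (T₁ : EqTheory L₁) (T₂ : EqTheory L₂) :
    EqTheory (L₁.sum L₂) :=
  (Prod.map (FirstOrder.Language.LHom.sumInl : L₁ →ᴸ L₁.sum L₂).onTerm
      (FirstOrder.Language.LHom.sumInl : L₁ →ᴸ L₁.sum L₂).onTerm '' T₁) ∪
    (Prod.map (FirstOrder.Language.LHom.sumInr : L₂ →ᴸ L₁.sum L₂).onTerm
      (FirstOrder.Language.LHom.sumInr : L₂ →ᴸ L₁.sum L₂).onTerm '' T₂)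

/-- Set-based models of `T` (possibly empty). -/
structure ModelCat {L : FirstOrder.Language.{u, v}} (T : EqTheory L) where
  /-- The underlying set. -/
  Carrier : Type w
  [struc : L.Structure Carrier]
  sat : ∀ e ∈ T, ∀ a : ℕ → Carrier, e.1.realize a = e.2.realize a

attribute [instance] ModelCat.struc

/-- The category of models, with homomorphisms as morphisms. -/
instance {L : FirstOrder.Language.{u, v}} (T : EqTheory L) : Category (ModelCat.{w, u, v} T) where
  Hom M N := FirstOrder.Language.Hom L M.Carrier N.Carrier
  id M := FirstOrder.Language.Hom.id L M.Carrier
  comp f g := FirstOrder.Language.Hom.comp g f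

/-- Provable equality as an equivalence relation on terms over `X`. -/
def provableSetoid {L : FirstOrder.Language.{u, v}} (T : EqTheory L) (X : Type w) : Setoid (L.Term X) where
  r := T.Provable
  iseqv := ⟨.refl, .symm, .trans⟩

/-- The underlying set of the free model on `X`: terms over `X` modulo provable equality. -/
abbrev FreeCarrier {L : FirstOrder.Language.{u, v}} (T : EqTheory L) (X : Type w) :=
  Quotient (T.provableSetoid X)

/-- The operations of the free model, computed on representatives. -/
noncomputable instance freeStructure {L : FirstOrder.Language.{u, v}} [L.IsAlgebraic] (T : EqTheory L)
    (X : Type w) : L.Structure (T.FreeCarrier X) where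
  funMap f xs := Quotient.mk _ (.func f fun i => (xs i).out)
  RelMap r := isEmptyElim r

theorem free_funMap_mk {L : FirstOrder.Language.{u, v}} [L.IsAlgebraic] (T : EqTheory L) (X : Type w)
    {n : ℕ} (f : L.Functions n) (ts : Fin n → L.Term X) :
    FirstOrder.Language.Structure.funMap f (fun i => (Quotient.mk _ (ts i) : T.FreeCarrier X)) =
      Quotient.mk _ (.func f ts) :=
  Quotient.sound (Provable.congr f fun i => Quotient.mk_out (s := T.provableSetoid X) (ts i))

theorem free_realize {L : FirstOrder.Language.{u, v}} [L.IsAlgebraic] (T : EqTheory L) (X : Type w)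
    (σ : ℕ → L.Term X) (t : L.Term ℕ) :
    t.realize (fun i => (Quotient.mk _ (σ i) : T.FreeCarrier X)) = Quotient.mk _ (t.subst σ) := by
  induction t with
  | var i => rfl
  | func f ts ih =>
    rw [FirstOrder.Language.Term.realize_func, FirstOrder.Language.Term.subst, ← free_funMap_mk]
    exact congrArg _ (funext ih)

/-- The free model of `T` on the generators `X`. -/
noncomputable def freeModel {L : FirstOrder.Language.{u, v}} [L.IsAlgebraic] (T : EqTheory L) (X : Type w) :
    ModelCat.{max u w, u, v} T where
  Carrier := T.FreeCarrier X
  sat e he a := by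
    have ha : a = fun i => Quotient.mk _ (a i).out := funext fun i => (Quotient.out_eq _).symm
    rw [ha, free_realize, free_realize]
    exact Quotient.sound (Provable.ax he _)

end EqTheory

/-- The (covariant) isotropy group of an object `M`: natural automorphisms of the forgetful
functor from the category of morphisms out of `M`. -/
abbrev IsotropyGroup {C : Type*} [Category C] (M : C) := Aut (Under.forget M)

/-- The canonical homomorphism from the global isotropy group of `C` to the isotropy group of `M`,
sending `α` to the family with component `α_N` at `h : M ⟶ N`. -/
def globalIsotropyHom {C : Type*} [Category C] (M : C) : Aut (𝟭 C) →* IsotropyGroup M where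
  toFun α := NatIso.ofComponents (fun h => α.app h.right) fun f => α.hom.naturality f.right
  map_one' := rfl
  map_mul' _ _ := rfl

/-! Colour each operation symbol by its theory and cut a term into alternating monochromatic layers,
the subterms below a layer playing the role of its variables. For each colour, fix one
representative per provable class of pure terms: a variable if possible, and free of dispensable
variables except a fixed placeholder. Terms canonical at every layer form a model of both theories
(`satisfies`), and evaluating a term there gives a provably equal normal form (`provable_realize`).

A natural automorphism of the identity acts on a free model with countably many generators as `p ↦
t(p)` for one term `t`; this map is injective and commutes with all operations. Suppose the normal
form of `t(y)` is not a variable; let `g` be its head, with `m` layers when counted from the colour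
of `g`. Take `f` of the other colour, neither constant nor a projection. Then `f(t(y₁), …, t(yₙ))`
has at least `m + 2` layers from the colour of `g` (`lt_layers_funMap`), while `t(f(y₁, …, yₙ))` has
at most `m + 1` (`layers_realize_le`). So `t(y)` is provably `y`, and naturality carries this from a
generator to every model. An initial `M₀` has the same isotropy group as the identity functor. -/

namespace EqTheory

open FirstOrder FirstOrder.Language

universe u v u' v' w'

/-! ### Variables and substitution -/

section Terms

variable {L : FirstOrder.Language.{u, v}} {α : Type w} {β : Type w'}

/-- The set of variables occurring in a term. -/
def vars : L.Term α → Set α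
  | .var a => {a}
  | .func _ ts => ⋃ i, vars (ts i)

@[simp] theorem vars_var (a : α) : vars (.var a : L.Term α) = {a} := rfl

@[simp] theorem vars_func {n : ℕ} (f : L.Functions n) (ts : Fin n → L.Term α) :
    vars (.func f ts) = ⋃ i, vars (ts i) := rfl

theorem finite_vars (t : L.Term α) : (vars t).Finite := by
  induction t with
  | var a => exact Set.finite_singleton a
  | func f ts ih => exact Set.finite_iUnion ih

theorem coe_varFinset [DecidableEq α] (t : L.Term α) : (t.varFinset : Set α) = vars t := by
  induction t with
  | var a => simp
  | func f ts ih => simp [ih]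

@[simp] theorem subst_var (a : α) (σ : α → L.Term β) :
    (Term.var a : L.Term α).subst σ = σ a := rfl

@[simp] theorem subst_func {n : ℕ} (f : L.Functions n) (ts : Fin n → L.Term α)
    (σ : α → L.Term β) :
    (Term.func f ts).subst σ = .func f fun i => (ts i).subst σ := rfl

theorem subst_subst {γ : Type*} (t : L.Term α) (σ : α → L.Term β) (τ : β → L.Term γ) :
    (t.subst σ).subst τ = t.subst fun a => (σ a).subst τ := by
  induction t with
  | var a => rfl
  | func f ts ih => simp [ih]

theorem subst_var_eq (t : L.Term α) : t.subst Term.var = t := by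
  induction t with
  | var a => rfl
  | func f ts ih => simp [ih]

theorem subst_congr {t : L.Term α} {σ τ : α → L.Term β} (h : ∀ a ∈ vars t, σ a = τ a) :
    t.subst σ = t.subst τ := by
  induction t with
  | var a => exact h a rfl
  | func f ts ih =>
    simp only [subst_func]
    congr 1
    funext i
    exact ih i fun a ha => h a (Set.mem_iUnion.2 ⟨i, ha⟩)

theorem mem_vars_subst {t : L.Term α} {σ : α → L.Term β} {b : β} :
    b ∈ vars (t.subst σ) ↔ ∃ a ∈ vars t, b ∈ vars (σ a) := by
  induction t with
  | var a => simp
  | func f ts ih =>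
    simp only [subst_func, vars_func, Set.mem_iUnion, ih]
    exact ⟨fun ⟨i, a, ha, hb⟩ => ⟨a, ⟨i, ha⟩, hb⟩, fun ⟨a, ⟨i, ha⟩, hb⟩ => ⟨i, a, ha, hb⟩⟩

end Terms

/-! ### Equational deduction -/

section Deduction

variable {L : FirstOrder.Language.{u, v}} {T : EqTheory L} {α : Type w} {β : Type w'}

theorem Provable.subst {s t : L.Term α} (h : T.Provable s t) (σ : α → L.Term β) :
    T.Provable (s.subst σ) (t.subst σ) := by
  induction h with
  | ax h τ =>
    rw [subst_subst, subst_subst]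
    exact .ax h _
  | refl t => exact .refl _
  | symm _ ih => exact ih.symm
  | trans _ _ ih₁ ih₂ => exact ih₁.trans ih₂
  | congr f _ ih => exact .congr f ih

theorem Provable.mono {T' : EqTheory L} (hT : T ⊆ T') {s t : L.Term α} (h : T.Provable s t) :
    T'.Provable s t := by
  induction h with
  | ax h τ => exact .ax (hT h) τ
  | refl t => exact .refl _
  | symm _ ih => exact ih.symm
  | trans _ _ ih₁ ih₂ => exact ih₁.trans ih₂
  | congr f _ ih => exact .congr f ih

theorem Provable.realize_eq {M : Type*} [L.Structure M]
    (hM : ∀ e ∈ T, ∀ a : ℕ → M, e.1.realize a = e.2.realize a) {s t : L.Term α}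
    (h : T.Provable s t) (a : α → M) : s.realize a = t.realize a := by
  induction h with
  | ax h τ =>
    rw [Term.realize_subst, Term.realize_subst]
    exact hM _ h _
  | refl t => rfl
  | symm _ ih => exact ih.symm
  | trans _ _ ih₁ ih₂ => exact ih₁.trans ih₂
  | congr f _ ih => simp only [Term.realize_func, ih]

/-- A theory with a non-constant operation does not identify distinct variables. -/
theorem eq_of_provable_var {n : ℕ} {f : L.Functions n} (hf : ¬ T.IsConstant f) {a b : α}
    (h : T.Provable (.var a) (.var b)) : a = b := by
  classical
  by_contra hab
  -- `n` is the first index not used by `generic f`. Sending `a` to `generic f` and all other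
  -- variables to `.var n` makes `f` constant.
  refine hf ⟨.var n, fun i => ?_, ?_⟩
  · simpa using i.2.ne
  · simpa [hab, Ne.symm hab] using
      h.subst fun c => if c = a then generic f else (.var n : L.Term ℕ)

/-- A non-constant operation applied to distinct variables depends on one of them. -/
theorem exists_mem_vars_of_provable {n : ℕ} {f : L.Functions n} (hf : ¬ T.IsConstant f)
    {x : Fin n → α} (hx : Function.Injective x) {q : L.Term α}
    (h : T.Provable (.func f fun i => .var (x i)) q) : ∃ i, x i ∈ vars q := by
  classical
  by_contra! hq
  -- Rename the arguments back to `y_0, …, y_{n-1}` and send everything else to `y_n`, which is not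
  -- an argument of `f`.
  let σ : α → L.Term ℕ := fun a => if h : ∃ i, x i = a then .var (h.choose : ℕ) else .var n
  have hσ : ∀ i, σ (x i) = .var (i : ℕ) := fun i => by
    have h : ∃ j, x j = x i := ⟨i, rfl⟩
    simp only [σ, dif_pos h, hx h.choose_spec]
  refine hf ⟨q.subst σ, fun i hi => ?_, ?_⟩
  · rw [← Finset.mem_coe, coe_varFinset, mem_vars_subst] at hi
    obtain ⟨a, ha, hi⟩ := hi
    have : ¬ ∃ j, x j = a := fun ⟨j, hj⟩ => hq j (hj ▸ ha)
    simp only [σ, dif_neg this, vars_var, Set.mem_singleton_iff] at hi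
    exact i.2.ne hi
  · simpa [hσ, generic] using h.subst σ

/-- An operation that is neither constant nor a projection is not provably a variable when applied
to distinct variables. -/
theorem not_provable_func_var {n : ℕ} {f : L.Functions n} (hf : ¬ T.IsConstant f)
    (hf' : ¬ T.IsProjection f) {x : Fin n → α} (hx : Function.Injective x) (a : α) :
    ¬ T.Provable (.func f fun i => .var (x i)) (.var a) := by
  classical
  intro h
  obtain ⟨i, rfl⟩ : ∃ i, x i = a := exists_mem_vars_of_provable hf hx h
  let σ : α → L.Term ℕ := fun a => if h : ∃ i, x i = a then .var (h.choose : ℕ) else .var n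
  have hσ : ∀ i, σ (x i) = .var (i : ℕ) := fun i => by
    have h : ∃ j, x j = x i := ⟨i, rfl⟩
    simp only [σ, dif_pos h, hx h.choose_spec]
  exact hf' ⟨i, by simpa [hσ, generic] using h.subst σ⟩

end Deduction

/-! ### Layers of a two-coloured term -/

section Layers

variable {L : FirstOrder.Language.{u, v}} (χ : (Σ n, L.Functions n) → Bool) (b : Bool)
variable {α : Type w} {β : Type w'}

/-- All operation symbols of the term have colour `b`. -/
def IsPure : L.Term α → Prop
  | .var _ => True
  | .func f ts => χ ⟨_, f⟩ = b ∧ ∀ i, IsPure (ts i)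

/-- The top layer of colour `b` of a term, with its maximal subterms not headed by a symbol of
colour `b` as variables. -/
def top : L.Term α → L.Term (L.Term α)
  | .var a => .var (.var a)
  | .func f ts => if χ ⟨_, f⟩ = b then .func f fun i => top (ts i) else .var (.func f ts)

/-- Flattening a term over terms. -/
def join (p : L.Term (L.Term α)) : L.Term α := p.subst id

@[simp] theorem join_var (t : L.Term α) : join (.var t) = t := rfl

@[simp] theorem join_func {n : ℕ} (f : L.Functions n) (ts : Fin n → L.Term (L.Term α)) :
    join (.func f ts) = .func f fun i => join (ts i) := rfl

@[simp] theorem top_var (a : α) : top χ b (.var a : L.Term α) = .var (.var a) := rfl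

variable {χ b}

theorem top_func_self {n : ℕ} {f : L.Functions n} (h : χ ⟨n, f⟩ = b) (ts : Fin n → L.Term α) :
    top χ b (.func f ts) = .func f fun i => top χ b (ts i) := if_pos h

theorem top_func_of_ne {n : ℕ} {f : L.Functions n} (h : χ ⟨n, f⟩ ≠ b) (ts : Fin n → L.Term α) :
    top χ b (.func f ts) = .var (.func f ts) := if_neg h

theorem join_top (t : L.Term α) : join (top χ b t) = t := by
  induction t with
  | var a => rfl
  | func f ts ih =>
    by_cases h : χ ⟨_, f⟩ = b
    · simp [top_func_self h, ih]
    · simp [top_func_of_ne h]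

theorem isPure_top (t : L.Term α) : IsPure χ b (top χ b t) := by
  induction t with
  | var a => trivial
  | func f ts ih =>
    by_cases h : χ ⟨_, f⟩ = b
    · rw [top_func_self h]
      exact ⟨h, ih⟩
    · rw [top_func_of_ne h]
      trivial

theorem IsPure.subst {t : L.Term α} (ht : IsPure χ b t) {σ : α → L.Term β}
    (hσ : ∀ a, IsPure χ b (σ a)) : IsPure χ b (t.subst σ) := by
  induction t with
  | var a => exact hσ a
  | func f ts ih => exact ⟨ht.1, fun i => ih i (ht.2 i)⟩

theorem top_of_mem_vars_top {t ℓ : L.Term α} (h : ℓ ∈ vars (top χ b t)) :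
    top χ b ℓ = .var ℓ := by
  induction t with
  | var a =>
    obtain rfl : ℓ = .var a := h
    rfl
  | func f ts ih =>
    by_cases hf : χ ⟨_, f⟩ = b
    · rw [top_func_self hf, vars_func, Set.mem_iUnion] at h
      exact ih _ h.choose_spec
    · rw [top_func_of_ne hf] at h
      obtain rfl : ℓ = .func f ts := h
      exact top_func_of_ne hf ts

theorem top_join {p : L.Term (L.Term α)} (hp : IsPure χ b p)
    (h : ∀ ℓ ∈ vars p, top χ b ℓ = .var ℓ) : top χ b (join p) = p := by
  induction p with
  | var t => exact h t rfl
  | func f ts ih =>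
    rw [join_func, top_func_self hp.1]
    congr 1
    funext i
    exact ih i (hp.2 i) fun ℓ hℓ => h ℓ (Set.mem_iUnion.2 ⟨i, hℓ⟩)

variable (χ)

/-- The number of layers of a term below an ambient layer of colour `b`. -/
def layers : L.Term α → Bool → ℕ
  | .var _, _ => 0
  | .func f ts, b =>
    (if χ ⟨_, f⟩ = b then 0 else 1) + Finset.univ.sup fun i => layers (ts i) (χ ⟨_, f⟩)

@[simp] theorem layers_var (a : α) (b : Bool) : layers χ (.var a : L.Term α) b = 0 := rfl

theorem layers_func {n : ℕ} (f : L.Functions n) (ts : Fin n → L.Term α) (b : Bool) :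
    layers χ (.func f ts) b =
      (if χ ⟨n, f⟩ = b then 0 else 1) + Finset.univ.sup fun i => layers χ (ts i) (χ ⟨n, f⟩) := rfl

theorem layers_le_add_one (t : L.Term α) (b b' : Bool) :
    layers χ t b ≤ layers χ t b' + 1 := by
  cases t with
  | var a => simp
  | func f ts =>
    rw [layers_func, layers_func]
    split_ifs <;> omega

theorem layers_func_of_ne {n : ℕ} {f : L.Functions n} {ts : Fin n → L.Term α} {b : Bool}
    (h : χ ⟨n, f⟩ ≠ b) :
    layers χ (.func f ts) b = layers χ (.func f ts) (χ ⟨n, f⟩) + 1 := by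
  rw [layers_func, layers_func, if_neg h, if_pos rfl]
  omega

variable {χ}

theorem layers_join_le {p : L.Term (L.Term α)} (hp : IsPure χ b p) {k : ℕ}
    (h : ∀ ℓ ∈ vars p, layers χ ℓ b ≤ k) : layers χ (join p) b ≤ k := by
  induction p with
  | var t => exact h t rfl
  | func f ts ih =>
    obtain ⟨rfl, hts⟩ := hp
    rw [join_func, layers_func, if_pos rfl, zero_add]
    exact Finset.sup_le fun i _ => ih i (hts i) fun ℓ hℓ => h ℓ (Set.mem_iUnion.2 ⟨i, hℓ⟩)

theorem layers_le_join {p : L.Term (L.Term α)} (hp : IsPure χ b p) {ℓ : L.Term α}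
    (h : ℓ ∈ vars p) : layers χ ℓ b ≤ layers χ (join p) b := by
  induction p with
  | var t =>
    obtain rfl : ℓ = t := h
    exact le_rfl
  | func f ts ih =>
    obtain ⟨rfl, hts⟩ := hp
    obtain ⟨i, hi⟩ := Set.mem_iUnion.1 h
    rw [join_func, layers_func, if_pos rfl, zero_add]
    exact (ih i (hts i) hi).trans
      (Finset.le_sup (f := fun i => layers χ (join (ts i)) _) (Finset.mem_univ i))

theorem layers_le_of_mem_vars_top {t ℓ : L.Term α} (h : ℓ ∈ vars (top χ b t)) :
    layers χ ℓ b ≤ layers χ t b := by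
  simpa only [join_top] using layers_le_join (isPure_top t) h

end Layers

/-- The union of a family of theories indexed by colours. -/
def joint {L : FirstOrder.Language.{u, v}} (T : Bool → EqTheory L) : EqTheory L := ⋃ b, T b

/-! ### Canonical representatives of pure terms -/

section Canonical

variable {L : FirstOrder.Language.{u, v}} (χ : (Σ n, L.Functions n) → Bool)

/-- `q` is a best representative of the provable equality class of `p` among terms of colour `b`:
it is a variable if possible, and all its variables other than `x₀` are indispensable. -/
structure IsReduct (T : EqTheory L) (b : Bool) {α : Type w} (x₀ : α) (p q : L.Term α) : Prop where
  isPure : IsPure χ b q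
  provable : T.Provable p q
  eq_var : ∀ a, T.Provable p (.var a) → q = .var a
  vars_subset : ∀ q', IsPure χ b q' → T.Provable p q' → vars q ⊆ insert x₀ (vars q')

variable {χ}

theorem exists_isReduct {T : EqTheory L} {b : Bool} {α : Type w} (x₀ : α)
    (hT : ∀ a a' : α, T.Provable (.var a) (.var a') → a = a') {p : L.Term α}
    (hp : IsPure χ b p) : ∃ q, IsReduct χ T b x₀ p q := by
  classical
  have eliminate : ∀ q q' : L.Term α, T.Provable p q → T.Provable p q' → ∀ a, a ∉ vars q' →
      T.Provable p (q.subst fun x => if x = a then .var x₀ else .var x) := by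
    intro q q' hq hq' a ha
    have h := (hq.symm.trans hq').subst fun x => if x = a then (.var x₀ : L.Term α) else .var x
    have h' : q'.subst (fun x => if x = a then (.var x₀ : L.Term α) else .var x) = q' := by
      conv_rhs => rw [← subst_var_eq q']
      exact subst_congr fun x hx => if_neg (ne_of_mem_of_not_mem hx ha)
    exact hq'.trans (h' ▸ h.symm)
  by_cases hv : ∃ a, T.Provable p (.var a)
  · obtain ⟨a, ha⟩ := hv
    refine ⟨.var a, trivial, ha, fun a' ha' => by rw [hT _ _ (ha.symm.trans ha')],
      fun q' _ hq' => ?_⟩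
    rintro x rfl
    by_contra hx
    rw [Set.mem_insert_iff, not_or] at hx
    have h := eliminate _ _ ha hq' x hx.2
    simp only [subst_var, if_true] at h
    exact hx.1 (hT _ _ (ha.symm.trans h))
  -- Minimise the number of variables other than `x₀`; eliminating a dispensable one would lower it.
  · have hex : ∃ k, ∃ q, IsPure χ b q ∧ T.Provable p q ∧ (vars q \ {x₀}).ncard = k :=
      ⟨_, p, hp, .refl p, rfl⟩
    obtain ⟨q, hq, hpq, hk⟩ := Nat.find_spec hex
    refine ⟨q, hq, hpq, fun a ha => absurd ⟨a, ha⟩ hv, fun q' _ hq' a ha => ?_⟩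
    by_contra hx
    rw [Set.mem_insert_iff, not_or] at hx
    have h := eliminate _ _ hpq hq' a hx.2
    refine Nat.find_min hex (m := (vars (q.subst fun x => if x = a then (.var x₀ : L.Term α)
      else .var x) \ {x₀}).ncard) ?_ ⟨_, hq.subst fun x => ?_, h, rfl⟩
    · rw [← hk]
      refine Set.ncard_lt_ncard ⟨?_, fun hs => ?_⟩ (finite_vars q).sdiff
      · rintro x ⟨hx', hx₀⟩
        obtain ⟨y, hy, hxy⟩ := mem_vars_subst.1 hx'
        split_ifs at hxy with hya
        · exact absurd hxy hx₀
        · obtain rfl : x = y := hxy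
          exact ⟨hy, hx₀⟩
      · obtain ⟨y, hy, hxy⟩ := mem_vars_subst.1 (hs ⟨ha, hx.1⟩).1
        split_ifs at hxy with hya
        · exact hx.1 hxy
        · exact hya (Eq.symm hxy)
    · split_ifs <;> trivial

/-- A choice of canonical representatives for the pure terms of each colour, over terms in `α`. -/
structure CanonicalForm (χ : (Σ n, L.Functions n) → Bool) (T : Bool → EqTheory L) {α : Type w}
    (y₀ : α) where
  /-- The canonical representative. -/
  form : Bool → L.Term (L.Term α) → L.Term (L.Term α)
  isReduct : ∀ b p, IsPure χ b p → IsReduct χ (T b) b (.var y₀) p (form b p)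
  congr : ∀ b p q, (T b).Provable p q → form b p = form b q

/-- Being a reduct of `p` depends only on the provable class of `p`, so choosing by the predicate
itself gives equal forms to provably equal terms. -/
theorem nonempty_canonicalForm {T : Bool → EqTheory L} {α : Type w} (y₀ : α)
    (hT : ∀ b, ∀ a a' : L.Term α, (T b).Provable (.var a) (.var a') → a = a') :
    Nonempty (CanonicalForm χ T y₀) := by
  have : Nonempty (L.Term (L.Term α)) := ⟨.var (.var y₀)⟩
  refine ⟨fun b p => Classical.epsilon (IsReduct χ (T b) b (.var y₀) p),
    fun b p hp => Classical.epsilon_spec (exists_isReduct _ (hT b) hp), fun b p q h => ?_⟩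
  have : IsReduct χ (T b) b (.var y₀) p = IsReduct χ (T b) b (.var y₀) q := by
    funext r
    refine propext ⟨fun hr => ?_, fun hr => ?_⟩
    · exact ⟨hr.1, h.symm.trans hr.2, fun a ha => hr.3 a (h.trans ha),
        fun q' hq' hp' => hr.4 q' hq' (h.trans hp')⟩
    · exact ⟨hr.1, h.trans hr.2, fun a ha => hr.3 a (h.symm.trans ha),
        fun q' hq' hp' => hr.4 q' hq' (h.symm.trans hp')⟩
  simp only [this]

end Canonical

/-! ### Normal forms -/

namespace CanonicalForm

variable {L : FirstOrder.Language.{u, v}} {χ : (Σ n, L.Functions n) → Bool}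
  {T : Bool → EqTheory L} {α : Type w} {y₀ : α} (κ : CanonicalForm χ T y₀)

theorem form_var (b : Bool) (t : L.Term α) : κ.form b (.var t) = .var t :=
  (κ.isReduct b (.var t) trivial).eq_var t (.refl _)

theorem form_form {b : Bool} {p : L.Term (L.Term α)} (hp : IsPure χ b p) :
    κ.form b (κ.form b p) = κ.form b p :=
  (κ.congr b _ _ (κ.isReduct b p hp).provable).symm

theorem vars_form_subset {b : Bool} {p : L.Term (L.Term α)} (hp : IsPure χ b p) :
    vars (κ.form b p) ⊆ insert (.var y₀) (vars p) :=
  (κ.isReduct b p hp).vars_subset p hp (.refl p)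

/-- Hereditarily canonical terms. -/
inductive IsNormal : L.Term α → Prop
  | var (a : α) : IsNormal (.var a)
  | func {n : ℕ} (f : L.Functions n) (ts : Fin n → L.Term α)
      (h : κ.form (χ ⟨n, f⟩) (top χ (χ ⟨n, f⟩) (.func f ts)) = top χ (χ ⟨n, f⟩) (.func f ts))
      (hv : ∀ ℓ ∈ vars (top χ (χ ⟨n, f⟩) (.func f ts)), IsNormal ℓ) : IsNormal (.func f ts)

variable {κ}

theorem IsNormal.form_top {t : L.Term α} (ht : κ.IsNormal t) (b : Bool) :
    κ.form b (top χ b t) = top χ b t := by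
  cases ht with
  | var a => exact κ.form_var b _
  | func f ts h hv =>
    by_cases hb : χ ⟨_, f⟩ = b
    · subst hb
      exact h
    · rw [top_func_of_ne hb, κ.form_var]

theorem IsNormal.of_mem_vars_top {t : L.Term α} (ht : κ.IsNormal t) {b : Bool} {ℓ : L.Term α}
    (hℓ : ℓ ∈ vars (top χ b t)) : κ.IsNormal ℓ := by
  cases ht with
  | var a =>
    obtain rfl : ℓ = .var a := hℓ
    exact .var a
  | func f ts h hv =>
    by_cases hb : χ ⟨_, f⟩ = b
    · subst hb
      exact hv ℓ hℓ
    · rw [top_func_of_ne hb] at hℓ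
      obtain rfl : ℓ = .func f ts := hℓ
      exact .func f ts h hv

theorem isNormal_join {b : Bool} {p : L.Term (L.Term α)} (hp : IsPure χ b p)
    (hform : κ.form b p = p) (htop : ∀ ℓ ∈ vars p, top χ b ℓ = .var ℓ)
    (hv : ∀ ℓ ∈ vars p, κ.IsNormal ℓ) : κ.IsNormal (join p) := by
  cases p with
  | var t => exact hv t rfl
  | func f ts =>
    have h := top_join hp htop
    obtain rfl := hp.1
    refine .func f _ ((congrArg _ h).trans (hform.trans h.symm)) fun ℓ hℓ => ?_
    change ℓ ∈ vars (top χ _ (join (.func f ts))) at hℓ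
    rw [h] at hℓ
    exact hv ℓ hℓ

variable (κ)

/-- The canonical form of `f` applied to the top layers of `xs`. -/
def opForm {n : ℕ} (f : L.Functions n) (xs : Fin n → L.Term α) : L.Term (L.Term α) :=
  κ.form (χ ⟨n, f⟩) (.func f fun i => top χ (χ ⟨n, f⟩) (xs i))

variable {κ}

theorem isPure_func_top {n : ℕ} (f : L.Functions n) (xs : Fin n → L.Term α) :
    IsPure χ (χ ⟨n, f⟩) (.func f fun i => top χ (χ ⟨n, f⟩) (xs i)) :=
  ⟨rfl, fun i => isPure_top (xs i)⟩

theorem isPure_opForm {n : ℕ} (f : L.Functions n) (xs : Fin n → L.Term α) :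
    IsPure χ (χ ⟨n, f⟩) (κ.opForm f xs) := (κ.isReduct _ _ (isPure_func_top f xs)).isPure

theorem mem_vars_opForm {n : ℕ} {f : L.Functions n} {xs : Fin n → L.Term α} {ℓ : L.Term α}
    (h : ℓ ∈ vars (κ.opForm f xs)) :
    ℓ = .var y₀ ∨ ∃ i, ℓ ∈ vars (top χ (χ ⟨n, f⟩) (xs i)) := by
  simpa using κ.vars_form_subset (isPure_func_top f xs) h

theorem top_of_mem_vars_opForm {n : ℕ} {f : L.Functions n} {xs : Fin n → L.Term α}
    {ℓ : L.Term α} (h : ℓ ∈ vars (κ.opForm f xs)) : top χ (χ ⟨n, f⟩) ℓ = .var ℓ := by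
  obtain rfl | ⟨i, hi⟩ := mem_vars_opForm h
  · rfl
  · exact top_of_mem_vars_top hi

theorem top_join_opForm {n : ℕ} (f : L.Functions n) (xs : Fin n → L.Term α) :
    top χ (χ ⟨n, f⟩) (join (κ.opForm f xs)) = κ.opForm f xs :=
  top_join (isPure_opForm f xs) fun _ => top_of_mem_vars_opForm

theorem isNormal_join_opForm {n : ℕ} (f : L.Functions n) {xs : Fin n → L.Term α}
    (hxs : ∀ i, κ.IsNormal (xs i)) : κ.IsNormal (join (κ.opForm f xs)) := by
  refine isNormal_join (isPure_opForm f xs) (κ.form_form (isPure_func_top f xs))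
    (fun _ => top_of_mem_vars_opForm) fun ℓ hℓ => ?_
  obtain rfl | ⟨i, hi⟩ := mem_vars_opForm hℓ
  · exact .var y₀
  · exact (hxs i).of_mem_vars_top hi

/-! ### The model of normal forms and its layer estimates -/

variable (κ)

/-- The set of normal forms, a model of both theories. -/
abbrev NormalForm := {t : L.Term α // κ.IsNormal t}

instance : L.Structure κ.NormalForm where
  funMap f xs := ⟨join (κ.opForm f fun i => (xs i).1), isNormal_join_opForm f fun i => (xs i).2⟩
  RelMap _ _ := True

theorem coe_funMap {n : ℕ} (f : L.Functions n) (xs : Fin n → κ.NormalForm) :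
    (Structure.funMap f xs : κ.NormalForm).1 = join (κ.opForm f fun i => (xs i).1) := rfl

/-- A variable as a normal form. -/
def normalVar (a : α) : κ.NormalForm := ⟨.var a, .var a⟩

/-- Canonicalising after each operation agrees with canonicalising once at the end, since `form`
respects provable equality. Pure equations of colour `b` can thus be checked on top layers alone. -/
theorem top_realize {b : Bool} {β : Type*} {e : L.Term β} (he : IsPure χ b e)
    (a : β → κ.NormalForm) :
    top χ b (e.realize a).1 = κ.form b (e.subst fun i => top χ b (a i).1) := by
  induction e with
  | var i => exact ((a i).2.form_top b).symm
  | func f ts ih =>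
    obtain ⟨rfl, hts⟩ := he
    rw [Term.realize_func, coe_funMap, top_join_opForm, opForm]
    refine κ.congr _ _ _ (.congr f fun i => ?_)
    rw [ih i (hts i)]
    exact ((κ.isReduct _ _ ((hts i).subst fun j => isPure_top _)).provable).symm

theorem satisfies (hT : ∀ b, ∀ e ∈ T b, IsPure χ b e.1 ∧ IsPure χ b e.2) :
    ∀ e ∈ joint T, ∀ a : ℕ → κ.NormalForm, e.1.realize a = e.2.realize a := by
  intro e he a
  obtain ⟨b, hb⟩ := Set.mem_iUnion.1 he
  refine Subtype.ext ?_
  rw [← join_top (χ := χ) (b := b) (e.1.realize a).1, κ.top_realize (hT b e hb).1,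
    κ.congr b _ _ (.ax hb _), ← κ.top_realize (hT b e hb).2, join_top]

theorem layers_funMap_le {n : ℕ} (f : L.Functions n) {xs : Fin n → κ.NormalForm} {k : ℕ}
    (h : ∀ i, layers χ (xs i).1 (χ ⟨n, f⟩) ≤ k) (b : Bool) :
    layers χ (Structure.funMap f xs : κ.NormalForm).1 b ≤ (if χ ⟨n, f⟩ = b then 0 else 1) + k := by
  have h' : layers χ (Structure.funMap f xs : κ.NormalForm).1 (χ ⟨n, f⟩) ≤ k := by
    refine layers_join_le (isPure_opForm f _) fun ℓ hℓ => ?_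
    obtain rfl | ⟨i, hi⟩ := mem_vars_opForm hℓ
    · simp
    · exact (layers_le_of_mem_vars_top hi).trans (h i)
  split_ifs with hb
  · subst hb
    simpa using h'
  · exact (layers_le_add_one χ _ b (χ ⟨n, f⟩)).trans (by omega)

/-- Canonicalisation never adds layers: it introduces no new variable except `y₀`, which has none.
-/
theorem layers_realize_le {β : Type*} (t : L.Term β) {a : β → κ.NormalForm} {m : ℕ}
    (h : ∀ i b, layers χ (a i).1 b ≤ m) (b : Bool) :
    layers χ (t.realize a).1 b ≤ layers χ t b + m := by
  induction t generalizing b with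
  | var i => simpa using h i b
  | func f ts ih =>
    rw [Term.realize_func, layers_func, add_assoc]
    refine κ.layers_funMap_le f (fun i => (ih i _).trans ?_) b
    gcongr
    exact Finset.le_sup (f := fun i => layers χ (ts i) _) (Finset.mem_univ i)

theorem provable_realize {β : Type*} (t : L.Term β) (a : β → κ.NormalForm) :
    (joint T).Provable (t.subst fun i => (a i).1) (t.realize a).1 := by
  induction t with
  | var i => exact .refl _
  | func f ts ih =>
    refine (Provable.congr f ih).trans ?_
    have h : (joint T).Provable (join (.func f fun i => top χ (χ ⟨_, f⟩) ((ts i).realize a).1))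
        (Term.realize a (.func f ts)).1 :=
      ((κ.isReduct _ _ (isPure_func_top f fun i => ((ts i).realize a).1)).provable.mono
        (Set.subset_iUnion T _)).subst id
    simpa only [join_func, join_top] using h

/-- In normal forms, an operation that is neither constant nor a projection adds a layer to
distinct arguments of the opposite colour. -/
theorem lt_layers_funMap {n : ℕ} {f : L.Functions n} (hf : ¬ (T (χ ⟨n, f⟩)).IsConstant f)
    (hf' : ¬ (T (χ ⟨n, f⟩)).IsProjection f) {xs : Fin n → κ.NormalForm}
    (hxs : Function.Injective xs) (htop : ∀ i, top χ (χ ⟨n, f⟩) (xs i).1 = .var (xs i).1)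
    {b : Bool} (hb : χ ⟨n, f⟩ ≠ b) {k : ℕ} (hk : ∀ i, k ≤ layers χ (xs i).1 (χ ⟨n, f⟩)) :
    k + 1 ≤ layers χ (Structure.funMap f xs : κ.NormalForm).1 b := by
  have hp := (κ.isReduct _ _ (isPure_func_top f fun i => (xs i).1)).provable
  simp only [htop] at hp
  have hinj : Function.Injective fun i => (xs i).1 := Subtype.val_injective.comp hxs
  obtain ⟨i, hi⟩ := exists_mem_vars_of_provable hf hinj hp
  have hlayers : k ≤ layers χ (Structure.funMap f xs : κ.NormalForm).1 (χ ⟨n, f⟩) := by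
    refine (hk i).trans (layers_le_join (isPure_opForm f _) ?_)
    simpa only [opForm, htop] using hi
  have hpure := isPure_opForm (κ := κ) f fun i => (xs i).1
  rw [coe_funMap] at hlayers ⊢
  simp only [opForm, htop] at hlayers hpure ⊢
  -- The canonical form `q` cannot be a variable, so its head has the colour of `f`; counting from
  -- the other colour `b` then adds one layer.
  generalize κ.form (χ ⟨n, f⟩) (.func f fun i => .var (xs i).1) = q at *
  cases q with
  | var ℓ => exact absurd hp (not_provable_func_var hf hf' hinj ℓ)
  | func g ts =>
    rw [← hpure.1] at hlayers hb
    rw [join_func] at hlayers ⊢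
    rw [layers_func_of_ne χ hb]
    omega

end CanonicalForm

/-! ### Central unary terms are trivial -/

section Central

variable {L : FirstOrder.Language.{u, v}} {χ : (Σ n, L.Functions n) → Bool}
  {T : Bool → EqTheory L}

/-- In the sum of two theories, each having an operation that is neither constant nor a projection,
an injective unary term that commutes with all operations is the variable. -/
theorem provable_of_central (hT : ∀ b, ∀ e ∈ T b, IsPure χ b e.1 ∧ IsPure χ b e.2)
    (hop : ∀ b, ∃ (n : ℕ) (f : L.Functions n), χ ⟨n, f⟩ = b ∧ ¬ (T b).IsConstant f ∧
      ¬ (T b).IsProjection f)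
    {α : Type w} (y₀ : α) (ι : ℕ ↪ α) (t : L.Term α)
    (hcomm : ∀ (n : ℕ) (f : L.Functions n) (ts : Fin n → L.Term α),
      (joint T).Provable (t.subst fun _ => .func f ts)
        (.func f fun i => t.subst fun _ => ts i))
    (hinj : ∀ a a' : α, (joint T).Provable (t.subst fun _ => .var a) (t.subst fun _ => .var a') →
      (joint T).Provable (.var a : L.Term α) (.var a')) :
    (joint T).Provable (t.subst fun _ => .var y₀) (.var y₀ : L.Term α) := by
  obtain ⟨κ⟩ : Nonempty (CanonicalForm χ T y₀) := nonempty_canonicalForm y₀ fun b a a' h => by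
    obtain ⟨n, f, -, hf, -⟩ := hop b
    exact eq_of_provable_var hf h
  have sound : ∀ {s s' : L.Term α}, (joint T).Provable s s' → ∀ a : α → κ.NormalForm,
      s.realize a = s'.realize a := fun h a => h.realize_eq (κ.satisfies hT) a
  let τ : α → κ.NormalForm := fun a => t.realize fun _ => κ.normalVar a
  have hτ : ∀ a, (joint T).Provable (t.subst fun _ => .var a) (τ a).1 := fun a =>
    κ.provable_realize t fun _ => κ.normalVar a
  -- The normal form of `t(a)` may also contain `y₀`, so all its variables are replaced by `p`.
  have hcollapse : ∀ a (p : L.Term α),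
      (joint T).Provable (t.subst fun _ => p) ((τ a).1.subst fun _ => p) := fun a p => by
    simpa only [subst_subst, subst_var] using (hτ a).subst fun _ => p
  have hrealize : ∀ a (x : κ.NormalForm),
      (t.realize fun _ => x) = (τ a).1.realize fun _ => x := fun a x => by
    simpa only [Term.realize_subst, Term.realize_var] using
      sound (hcollapse a (.var a)) fun _ => x
  have hinj' : Function.Injective τ := fun a a' h => by
    have h' := sound (hinj a a' ((hτ a).trans (h ▸ (hτ a').symm))) κ.normalVar
    simpa [CanonicalForm.normalVar] using h'
  -- Each `τ a` is also the value of `τ a'` at `a`, so all `τ a` have equally many layers, from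
  -- either colour.
  have hle : ∀ a a' b, layers χ (τ a).1 b ≤ layers χ (τ a').1 b := fun a a' b => by
    have := κ.layers_realize_le (τ a').1 (a := fun _ => κ.normalVar a) (m := 0)
      (fun i b => le_rfl) b
    rwa [← hrealize] at this
  rcases hhead : (τ y₀).1 with a | ⟨g, ts⟩
  · simpa [hhead] using hcollapse y₀ (.var y₀)
  -- The head `g` is to be contradicted by an operation of the opposite colour.
  · obtain ⟨n, f, hfg, hf, hf'⟩ := hop (!χ ⟨_, g⟩)
    have hne : χ ⟨n, f⟩ ≠ χ ⟨_, g⟩ := by simp [hfg]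
    rw [← hfg] at hf hf'
    have hlayers : layers χ (τ y₀).1 (χ ⟨n, f⟩) = layers χ (τ y₀).1 (χ ⟨_, g⟩) + 1 := by
      rw [hhead, layers_func_of_ne χ hne.symm]
    let ys : Fin n → α := fun i => ι i
    have hys : Function.Injective ys := ι.injective.comp Fin.val_injective
    -- No `τ a` has a head of the colour of `f`: that would reverse which colour gives the larger
    -- layer count, against `hle`.
    have htop : ∀ a, top χ (χ ⟨n, f⟩) (τ a).1 = .var (τ a).1 := fun a => by
      rcases hτa : (τ a).1 with c | ⟨g', ts'⟩
      · rfl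
      · refine top_func_of_ne (fun h => ?_) _
        have h₁ : layers χ (τ a).1 (χ ⟨_, g⟩) = layers χ (τ a).1 (χ ⟨n, f⟩) + 1 := by
          rw [hτa, layers_func_of_ne χ (h ▸ hne), h]
        have h₂ := hle a y₀ (χ ⟨_, g⟩)
        have h₃ := hle y₀ a (χ ⟨n, f⟩)
        omega
    have hlower := κ.lt_layers_funMap hf hf' (xs := fun i => τ (ys i)) (hinj'.comp hys)
      (fun i => htop _) hne fun i => hle y₀ (ys i) _
    have hcommute : (t.realize fun _ => Structure.funMap f fun i => κ.normalVar (ys i)) =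
        (Structure.funMap f fun i => τ (ys i) : κ.NormalForm) := by
      simpa only [Term.realize_subst, Term.realize_func, Term.realize_var] using
        sound (hcomm n f fun i => .var (ys i)) κ.normalVar
    -- Here `m = 1` because `f` applied to variables has at most one layer.
    have hupper := κ.layers_realize_le (τ y₀).1 (m := 1)
      (a := fun _ => Structure.funMap f fun i => κ.normalVar (ys i))
      (fun _ b => (κ.layers_funMap_le f (k := 0) (fun i => le_rfl) b).trans
        (by split_ifs <;> omega)) (χ ⟨_, g⟩)
    rw [← hrealize, hcommute] at hupper
    omega

end Central

end EqTheory

namespace EqTheory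

open FirstOrder FirstOrder.Language

universe u v u' v'

/-! ### Conservativity over one summand -/

section Retract

variable {L : FirstOrder.Language.{u, v}} {L' : FirstOrder.Language.{u', v'}} {α : Type*}
  (r : ∀ n, L'.Functions n → Option (L.Functions n))

/-- Translate a term along a partial map of signatures, replacing each maximal subterm headed by a
symbol outside the domain by the variable `a₀`. -/
def retract (a₀ : α) : L'.Term α → L.Term α
  | .var a => .var a
  | .func (l := n) f ts =>
    match r n f with
    | some g => .func g fun i => retract a₀ (ts i)
    | none => .var a₀

variable {r}

theorem retract_func_some {a₀ : α} {n : ℕ} {f : L'.Functions n} {g : L.Functions n}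
    (h : r n f = some g) (ts : Fin n → L'.Term α) :
    retract r a₀ (.func f ts) = .func g fun i => retract r a₀ (ts i) := by
  simp only [retract, h]

theorem retract_func_none {a₀ : α} {n : ℕ} {f : L'.Functions n} (h : r n f = none)
    (ts : Fin n → L'.Term α) : retract r a₀ (.func f ts) = .var a₀ := by
  simp only [retract, h]

variable {φ : L →ᴸ L'}

theorem vars_retract_subset (a₀ : α) (t : L'.Term α) :
    vars (retract r a₀ t) ⊆ insert a₀ (vars t) := by
  induction t with
  | var a => exact Set.subset_insert _ _
  | func f ts ih =>
    rcases hf : r _ f with _ | g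
    · simp [retract_func_none hf]
    · rw [retract_func_some hf, vars_func, vars_func]
      exact Set.iUnion_subset fun i => (ih i).trans
        (Set.insert_subset_insert (Set.subset_iUnion (fun i => vars (ts i)) i))

theorem retract_subst_onTerm (hr : ∀ n (f : L.Functions n), r n (φ.onFunction f) = some f)
    {β : Type*} (a₀ : α) (t : L.Term β) (σ : β → L'.Term α) :
    retract r a₀ ((φ.onTerm t).subst σ) = t.subst fun i => retract r a₀ (σ i) := by
  induction t with
  | var i => rfl
  | func f ts ih =>
    rw [LHom.onTerm, subst_func, retract_func_some (hr _ f), subst_func]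
    simp only [ih]

/-- Axiom instances retract to axiom instances, and a congruence step under a foreign symbol becomes
reflexivity. Hence enlarging the signature makes no operation newly constant or a projection. -/
theorem provable_retract (hr : ∀ n (f : L.Functions n), r n (φ.onFunction f) = some f)
    {T : EqTheory L} (a₀ : α) {s t : L'.Term α}
    (h : EqTheory.Provable (Prod.map φ.onTerm φ.onTerm '' T) s t) :
    T.Provable (retract r a₀ s) (retract r a₀ t) := by
  induction h with
  | ax h σ =>
    obtain ⟨e, he, heq⟩ := h
    obtain ⟨rfl, rfl⟩ := Prod.mk.inj heq
    rw [retract_subst_onTerm hr, retract_subst_onTerm hr]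
    exact .ax he _
  | refl t => exact .refl _
  | symm _ ih => exact ih.symm
  | trans _ _ ih₁ ih₂ => exact ih₁.trans ih₂
  | congr f _ ih =>
    rcases hf : r _ f with _ | g
    · rw [retract_func_none hf, retract_func_none hf]
      exact .refl _
    · rw [retract_func_some hf, retract_func_some hf]
      exact .congr g ih

theorem retract_generic (hr : ∀ n (f : L.Functions n), r n (φ.onFunction f) = some f) (a₀ : ℕ)
    {n : ℕ} (f : L.Functions n) :
    retract r a₀ (generic (φ.onFunction f)) = generic f := retract_func_some (hr n f) _

theorem IsConstant.of_image (hr : ∀ n (f : L.Functions n), r n (φ.onFunction f) = some f)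
    {T : EqTheory L} {n : ℕ} {f : L.Functions n}
    (h : EqTheory.IsConstant (Prod.map φ.onTerm φ.onTerm '' T) (φ.onFunction f)) :
    T.IsConstant f := by
  obtain ⟨s, hs, h⟩ := h
  refine ⟨retract r n s, fun i hi => ?_, retract_generic hr n f ▸ provable_retract hr n h⟩
  rw [← Finset.mem_coe, coe_varFinset] at hi
  obtain hi | hi := vars_retract_subset n s hi
  · exact i.2.ne hi
  · rw [← coe_varFinset, Finset.mem_coe] at hi
    exact hs i hi

theorem IsProjection.of_image (hr : ∀ n (f : L.Functions n), r n (φ.onFunction f) = some f)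
    {T : EqTheory L} {n : ℕ} {f : L.Functions n}
    (h : EqTheory.IsProjection (Prod.map φ.onTerm φ.onTerm '' T) (φ.onFunction f)) :
    T.IsProjection f := by
  obtain ⟨i, h⟩ := h
  exact ⟨i, retract_generic hr n f ▸ provable_retract hr n h⟩

theorem isPure_onTerm {χ : (Σ n, L'.Functions n) → Bool} {b : Bool}
    (hφ : ∀ n (f : L.Functions n), χ ⟨n, φ.onFunction f⟩ = b) (t : L.Term α) :
    IsPure χ b (φ.onTerm t) := by
  induction t with
  | var a => trivial
  | func f ts ih => exact ⟨hφ _ f, ih⟩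

end Retract

/-! ### The two summands as coloured theories -/

section Sum

variable {L₁ : FirstOrder.Language.{u, v}} {L₂ : FirstOrder.Language.{u', v'}}

/-- The signature of origin of an operation symbol of a sum. -/
def sumColour (f : Σ n, (L₁.sum L₂).Functions n) : Bool := Sum.isLeft f.2

/-- The two summands of a sum of theories, over the joint signature. -/
def summand (T₁ : EqTheory L₁) (T₂ : EqTheory L₂) (b : Bool) : EqTheory (L₁.sum L₂) :=
  cond b (Prod.map (LHom.sumInl : L₁ →ᴸ L₁.sum L₂).onTerm
      (LHom.sumInl : L₁ →ᴸ L₁.sum L₂).onTerm '' T₁)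
    (Prod.map (LHom.sumInr : L₂ →ᴸ L₁.sum L₂).onTerm
      (LHom.sumInr : L₂ →ᴸ L₁.sum L₂).onTerm '' T₂)

theorem joint_summand (T₁ : EqTheory L₁) (T₂ : EqTheory L₂) :
    joint (summand T₁ T₂) = T₁.sum T₂ :=
  (Set.iUnion_congr (t := fun b => cond b (summand T₁ T₂ true) (summand T₁ T₂ false))
    fun b => by cases b <;> rfl).trans Set.union_eq_iUnion.symm

theorem isPure_summand (T₁ : EqTheory L₁) (T₂ : EqTheory L₂) (b : Bool) :
    ∀ e ∈ summand T₁ T₂ b, IsPure sumColour b e.1 ∧ IsPure sumColour b e.2 := by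
  cases b <;> rintro _ ⟨e, -, rfl⟩ <;>
    exact ⟨isPure_onTerm (fun _ _ => rfl) _, isPure_onTerm (fun _ _ => rfl) _⟩

theorem exists_summand_operation {T₁ : EqTheory L₁} {T₂ : EqTheory L₂}
    (h₁ : ∃ (n : ℕ) (f : L₁.Functions n), 1 ≤ n ∧ ¬ T₁.IsConstant f ∧ ¬ T₁.IsProjection f)
    (h₂ : ∃ (n : ℕ) (f : L₂.Functions n), 1 ≤ n ∧ ¬ T₂.IsConstant f ∧ ¬ T₂.IsProjection f)
    (b : Bool) : ∃ (n : ℕ) (f : (L₁.sum L₂).Functions n), sumColour ⟨n, f⟩ = b ∧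
      ¬ (summand T₁ T₂ b).IsConstant f ∧ ¬ (summand T₁ T₂ b).IsProjection f := by
  cases b
  · obtain ⟨n, f, -, hc, hp⟩ := h₂
    have hr : ∀ n (f : L₂.Functions n),
        Sum.getRight? ((LHom.sumInr : L₂ →ᴸ L₁.sum L₂).onFunction f) = some f := fun _ _ => rfl
    exact ⟨n, (LHom.sumInr : L₂ →ᴸ L₁.sum L₂).onFunction f, rfl,
      fun h => hc (.of_image (r := fun _ => Sum.getRight?) hr h),
      fun h => hp (.of_image (r := fun _ => Sum.getRight?) hr h)⟩
  · obtain ⟨n, f, -, hc, hp⟩ := h₁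
    have hr : ∀ n (f : L₁.Functions n),
        Sum.getLeft? ((LHom.sumInl : L₁ →ᴸ L₁.sum L₂).onFunction f) = some f := fun _ _ => rfl
    exact ⟨n, (LHom.sumInl : L₁ →ᴸ L₁.sum L₂).onFunction f, rfl,
      fun h => hc (.of_image (r := fun _ => Sum.getLeft?) hr h),
      fun h => hp (.of_image (r := fun _ => Sum.getLeft?) hr h)⟩

end Sum

/-! ### Free models and natural endomorphisms -/

section Free

variable {L : FirstOrder.Language.{u, v}} {T : EqTheory L} {X : Type w}

/-- The class of a term in the free model. -/
def freeMk (T : EqTheory L) (p : L.Term X) : T.FreeCarrier X := Quotient.mk _ p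

theorem freeMk_eq_iff {p q : L.Term X} : freeMk T p = freeMk T q ↔ T.Provable p q := Quotient.eq

theorem exists_freeMk (x : T.FreeCarrier X) : ∃ p, freeMk T p = x := Quotient.exists_rep x

/-- The homomorphism of structures underlying a morphism of models. -/
def ModelCat.toHom {M N : ModelCat.{w} T} (f : M ⟶ N) : M.Carrier →[L] N.Carrier := f

theorem ModelCat.hom_ext {M N : ModelCat.{w} T} {f g : M ⟶ N}
    (h : ∀ x, toHom f x = toHom g x) : f = g :=
  FirstOrder.Language.Hom.ext h

theorem toHom_naturality (z : 𝟭 (ModelCat.{w} T) ⟶ 𝟭 _) {M N : ModelCat.{w} T} (f : M ⟶ N)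
    (x : M.Carrier) :
    ModelCat.toHom (z.app N) (ModelCat.toHom f x) =
      ModelCat.toHom f (ModelCat.toHom (z.app M) x) :=
  congrArg (fun k : M ⟶ N => ModelCat.toHom k x) (z.naturality f)

variable [L.IsAlgebraic]

theorem realize_freeMk {β : Type*} (t : L.Term β) (σ : β → L.Term X) :
    t.realize (fun i => freeMk T (σ i)) = freeMk T (t.subst σ) := by
  induction t with
  | var i => rfl
  | func f ts ih =>
    rw [Term.realize_func, funext ih]
    exact free_funMap_mk T X f _

/-- The homomorphism out of the free model extending a map on generators. -/
def freeLift (M : ModelCat.{max u w} T) (a : X → M.Carrier) : T.freeModel X ⟶ M :=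
  show FirstOrder.Language.Hom L (T.FreeCarrier X) M.Carrier from
  { toFun := Quotient.lift (fun p : L.Term X => p.realize a)
      fun _ _ h => Provable.realize_eq M.sat h a
    map_fun' := fun f xs => by
      choose ps hps using fun i => exists_freeMk (xs i)
      obtain rfl : (fun i => freeMk T (ps i)) = xs := funext hps
      exact congrArg (Quotient.lift (fun p : L.Term X => p.realize a)
      fun _ _ h => Provable.realize_eq M.sat h a)
        (free_funMap_mk T X f ps)
    map_rel' := fun r => isEmptyElim r }

theorem freeModel_hom_ext {M : ModelCat.{max u w} T} {f g : T.freeModel X ⟶ M}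
    (h : ∀ x, ModelCat.toHom f (freeMk T (.var x)) = ModelCat.toHom g (freeMk T (.var x))) :
    f = g := by
  refine ModelCat.hom_ext fun y => ?_
  obtain ⟨p, rfl⟩ := exists_freeMk y
  have key : ∀ k : T.freeModel X ⟶ M, ModelCat.toHom k (freeMk T p) =
      p.realize fun x => ModelCat.toHom k (freeMk T (.var x)) := fun k => by
    have hp := realize_freeMk (T := T) p Term.var
    rw [subst_var_eq] at hp
    rw [← hp]
    exact (HomClass.realize_term (ModelCat.toHom k)).symm
  rw [key f, key g, funext h]

/-- The free model on an empty set of generators is initial. -/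
noncomputable def freeModelIsInitial (T : EqTheory L) [IsEmpty X] : Limits.IsInitial (T.freeModel X) :=
  Limits.IsInitial.ofUniqueHom (fun M => freeLift M isEmptyElim)
    fun _ _ => freeModel_hom_ext fun x => isEmptyElim x

/-- Naturality along the endomorphism sending every generator to `p`; hence all variables of `t`
become `p`. -/
theorem toHom_app_freeMk (z : 𝟭 (ModelCat.{max u w} T) ⟶ 𝟭 _) (y₀ : X) {t : L.Term X}
    (ht : ModelCat.toHom (z.app (T.freeModel X)) (freeMk T (.var y₀)) = freeMk T t)
    (p : L.Term X) :
    ModelCat.toHom (z.app (T.freeModel X)) (freeMk T p) = freeMk T (t.subst fun _ => p) := by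
  have h := toHom_naturality z (freeLift (T.freeModel X) fun _ : X => freeMk T p)
    (freeMk T (.var y₀))
  rw [ht] at h
  exact h.trans (realize_freeMk t _)

/-- A natural endomorphism of the identity functor of models is the identity if it fixes a
generator of a free model. -/
theorem eq_id_of_fixes_generator (z : 𝟭 (ModelCat.{max u w} T) ⟶ 𝟭 _) (y₀ : X)
    (h : ModelCat.toHom (z.app (T.freeModel X)) (freeMk T (.var y₀)) = freeMk T (.var y₀)) :
    z = 𝟙 _ := by
  ext M
  refine ModelCat.hom_ext fun m => ?_
  have h' := toHom_naturality z (freeLift M fun _ : X => m) (freeMk T (.var y₀))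
  rw [h] at h'
  exact h'

end Free

end EqTheory

/-! ### Isotropy of an initial object -/

section Isotropy

variable {C : Type*} [Category C] {M : C}

/-- Every object has exactly one morphism from `M`, and every morphism of `C` commutes with these,
so families over `Under M` and over `C` coincide. -/
theorem globalIsotropyHom_bijective (hM : Limits.IsInitial M) :
    Function.Bijective (globalIsotropyHom M) := by
  refine ⟨fun α β h => ?_, fun β => ⟨NatIso.ofComponents
    (fun N => β.app (Under.mk (hM.to N))) fun {N N'} f => ?_, ?_⟩⟩
  · ext N
    exact congrArg (fun γ : IsotropyGroup M => γ.hom.app (Under.mk (hM.to N))) h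
  · exact β.hom.naturality (Under.homMk f (hM.hom_ext _ _) :
      Under.mk (hM.to N) ⟶ Under.mk (hM.to N'))
  · ext h
    obtain ⟨⟨⟨⟩⟩, N, h⟩ := h
    obtain rfl : hM.to N = h := hM.hom_ext _ _
    rfl

end Isotropy

theorem EqTheory.aut_id_sum_eq_one {L₁ : FirstOrder.Language.{u₁, v₁}}
    {L₂ : FirstOrder.Language.{u₂, v₂}} [L₁.IsAlgebraic] [L₂.IsAlgebraic]
    (T₁ : EqTheory L₁) (T₂ : EqTheory L₂)
    (h₁ : ∃ (n : ℕ) (f : L₁.Functions n), 1 ≤ n ∧ ¬ T₁.IsConstant f ∧ ¬ T₁.IsProjection f)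
    (h₂ : ∃ (n : ℕ) (f : L₂.Functions n), 1 ≤ n ∧ ¬ T₂.IsConstant f ∧ ¬ T₂.IsProjection f)
    (α : Aut (𝟭 (EqTheory.ModelCat.{max u₁ u₂ w, max u₁ u₂, max v₁ v₂} (T₁.sum T₂)))) :
    α = 1 := by
  let X := ULift.{w} ℕ
  let F := (T₁.sum T₂).freeModel X
  let y₀ : X := ⟨0⟩
  obtain ⟨t, ht⟩ := EqTheory.exists_freeMk
    (ModelCat.toHom (α.hom.app F) (freeMk (T₁.sum T₂) (.var y₀)))
  have happ := toHom_app_freeMk α.hom y₀ ht.symm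
  have hleft : ∀ x, ModelCat.toHom (α.inv.app F) (ModelCat.toHom (α.hom.app F) x) = x := fun x =>
    congrArg (fun z : 𝟭 (ModelCat (T₁.sum T₂)) ⟶ 𝟭 _ => ModelCat.toHom (z.app F) x) α.hom_inv_id
  have hcentral := provable_of_central (isPure_summand T₁ T₂) (exists_summand_operation h₁ h₂) y₀
    ⟨ULift.up, ULift.up_injective⟩ t
  rw [joint_summand] at hcentral
  refine Iso.ext (eq_id_of_fixes_generator α.hom y₀ ((happ _).trans (freeMk_eq_iff.2
    (hcentral (fun n f ts => ?_) fun a a' h => ?_))))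
  -- Commutation with operations: the component of `α` is a homomorphism.
  · rw [← freeMk_eq_iff, ← happ]
    have h := (ModelCat.toHom (α.hom.app F)).map_fun f fun i => freeMk (T₁.sum T₂) (ts i)
    have h' : ModelCat.toHom (α.hom.app F) (freeMk (T₁.sum T₂) (.func f ts)) = _ :=
      (congrArg _ (free_funMap_mk (T₁.sum T₂) X f ts).symm).trans h
    rw [h']
    refine Eq.trans ?_ (free_funMap_mk (T₁.sum T₂) X f _)
    exact congrArg (FirstOrder.Language.Structure.funMap f) (funext fun i => happ (ts i))
  -- Injectivity: the component of `α` has a left inverse.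
  · rw [← freeMk_eq_iff] at h ⊢
    rw [← happ, ← happ] at h
    exact (hleft _).symm.trans ((congrArg _ h).trans (hleft _))

theorem corollary2 {L₁ : FirstOrder.Language.{u₁, v₁}} {L₂ : FirstOrder.Language.{u₂, v₂}}
    [L₁.IsAlgebraic] [L₂.IsAlgebraic] (T₁ : EqTheory L₁) (T₂ : EqTheory L₂)
    (h₁ : ∃ (n : ℕ) (f : L₁.Functions n), 1 ≤ n ∧ ¬ T₁.IsConstant f ∧ ¬ T₁.IsProjection f)
    (h₂ : ∃ (n : ℕ) (f : L₂.Functions n), 1 ≤ n ∧ ¬ T₂.IsConstant f ∧ ¬ T₂.IsProjection f) :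
    -- the free model `M₀` on no generators is initial
    Nonempty (Limits.IsInitial (EqTheory.freeModel (T₁.sum T₂) PEmpty.{w + 1})) ∧
    -- the global isotropy group is identified with the isotropy group of `M₀`
    Function.Bijective (globalIsotropyHom (EqTheory.freeModel (T₁.sum T₂) PEmpty.{w + 1})) ∧
    Subsingleton (IsotropyGroup (EqTheory.freeModel (T₁.sum T₂) PEmpty.{w + 1})) ∧
    -- the global isotropy group is trivial
    (∀ α : Aut (𝟭 (EqTheory.ModelCat.{max u₁ u₂ w, max u₁ u₂, max v₁ v₂} (T₁.sum T₂))), α = 1) ∧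
    -- the centre has no nontrivial invertible element
    (∀ z : (CatCenter (EqTheory.ModelCat.{max u₁ u₂ w, max u₁ u₂, max v₁ v₂} (T₁.sum T₂)))ˣ,
      z = 1) := by
  have hM := EqTheory.freeModelIsInitial (T₁.sum T₂) (X := PEmpty.{w + 1})
  have hbij := globalIsotropyHom_bijective hM
  have htriv := EqTheory.aut_id_sum_eq_one.{u₁, v₁, u₂, v₂, w} T₁ T₂ h₁ h₂
  refine ⟨⟨hM⟩, hbij, ⟨fun β γ => ?_⟩, htriv, fun z => ?_⟩
  · obtain ⟨β, rfl⟩ := hbij.2 β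
    obtain ⟨γ, rfl⟩ := hbij.2 γ
    rw [htriv β, htriv γ]
  · exact (Aut.unitsEndEquivAut _).injective ((htriv _).trans (map_one _).symm)
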